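/- Let $R$ be an associative ring with identity. Modules are left $R$-modules and complexes are cochain complexes $\cdots\to X^{i-1}\to X^{i}\to X^{i+1}\to\cdots$ indexed by $i\in\mathbb{Z}$. A short exact sequence $0\to A\to B\to C\to 0$ of $R$-modules is pure exact if $0\to M\otimes_R A\to M\otimes_R B\to M\otimes_R C\to 0$ is exact for every right $R$-module $M$; then $A\to B$ is called pure monic and $B\to C$ pure epic. A module is pure projective if it is projective with respect to all pure exact sequences. A complex $X$ is pure exact if for every $n\in\mathbb{Z}$ the differentials $d^{n-1}$ and $d^{n}$ each factor as a pure epic map followed by a pure monic map and the sequence $0\to\operatorname{Ker} d^{n}\to X^{n}\to\operatorname{Coker} d^{n-1}\to 0$ is pure exact. (The same definitions apply over the ring $\mathbb{Z}$.) A cochain map is a pure quasi-isomorphism if its mapping cone is pure exact. For complexes $X,Y$ of $R$-modules, $\operatorname{Hom}_R(X,Y)$ is the total complex of $\mathbb{Z}$-modules with $\prod_{i\in\mathbb{Z}}\operatorname{Hom}_R(X^{i},Y^{i+n})$ in degree $n$ and differential $\varphi\mapsto (d_Y^{i+n}\varphi^{i}-(-1)^{n}\varphi^{i+1}d_X^{i})_{i\in\mathbb{Z}}$.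 Theorem 5.1. Let $X$ be a bounded below complex of $R$-modules, that is, there is $n\in\mathbb{Z}$ with $X^{i}=0$ for all $i<n$. Then $X$ has a pure projective resolution: there exist a complex $P$ all of whose terms $P^{i}$ are pure projective $R$-modules and a cochain map $f:P\to X$ such that (1) $f$ is a pure quasi-isomorphism, and (2) $\operatorname{Hom}_R(P,-)$ preserves pure exact complexes: for every pure exact complex $Y$ of $R$-modules, $\operatorname{Hom}_R(P,Y)$ is a pure exact complex of $\mathbb{Z}$-modules. -/

import Mathlib

open CategoryTheory CategoryTheory.Limits
open scoped TensorProduct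

universe u v

namespace PureComplex

/-! ### The tensor product over an arbitrary ring

A right `R`-module is a left module over the opposite ring `Rᵐᵒᵖ`, so that `x · r` is
`MulOpposite.op r • x`. -/

section Tensor

/-- The subgroup of `M ⊗_ℤ A` generated by the elements `(x · r) ⊗ a - x ⊗ (r · a)`. -/
def balancedRel (R : Type v) [Ring R] (M : Type*) [AddCommGroup M] [Module Rᵐᵒᵖ M]
    (A : Type*) [AddCommGroup A] [Module R A] : AddSubgroup (M ⊗[ℤ] A) :=
  AddSubgroup.closure
    {t | ∃ (x : M) (r : R) (a : A), t = (MulOpposite.op r • x) ⊗ₜ[ℤ] a - x ⊗ₜ[ℤ] (r • a)}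

/-- The abelian group `M ⊗_R A`, for a right `R`-module `M` and a left `R`-module `A`. -/
abbrev BalancedTensor (R : Type v) [Ring R] (M : Type*) [AddCommGroup M] [Module Rᵐᵒᵖ M]
    (A : Type*) [AddCommGroup A] [Module R A] : Type _ :=
  (M ⊗[ℤ] A) ⧸ balancedRel R M A

/-- The map `M ⊗_ℤ f : M ⊗_ℤ A → M ⊗_ℤ B` induced by an `R`-linear map `f : A → B`. -/
def intTensorMap {R : Type v} [Ring R] (M : Type*) [AddCommGroup M]
    {A B : Type*} [AddCommGroup A] [Module R A] [AddCommGroup B] [Module R B] (f : A →ₗ[R] B) :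
    M ⊗[ℤ] A →+ M ⊗[ℤ] B :=
  (TensorProduct.map (LinearMap.id : M →ₗ[ℤ] M)
    f.toAddMonoidHom.toIntLinearMap).toAddMonoidHom

theorem intTensorMap_tmul {R : Type v} [Ring R] {M : Type*} [AddCommGroup M]
    {A B : Type*} [AddCommGroup A] [Module R A] [AddCommGroup B] [Module R B] (f : A →ₗ[R] B)
    (x : M) (a : A) : intTensorMap M f (x ⊗ₜ[ℤ] a) = x ⊗ₜ[ℤ] f a :=
  rfl

theorem balancedRel_le_comap {R : Type v} [Ring R] (M : Type*) [AddCommGroup M] [Module Rᵐᵒᵖ M]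
    {A B : Type*} [AddCommGroup A] [Module R A] [AddCommGroup B] [Module R B] (f : A →ₗ[R] B) :
    balancedRel R M A ≤ (balancedRel R M B).comap (intTensorMap M f) := by
  rw [balancedRel, AddSubgroup.closure_le]
  rintro _ ⟨x, r, a, rfl⟩
  refine AddSubgroup.subset_closure ⟨x, r, f a, ?_⟩
  rw [map_sub, intTensorMap_tmul, intTensorMap_tmul, map_smul]

/-- The map `M ⊗_R f : M ⊗_R A → M ⊗_R B` induced by an `R`-linear map `f : A → B`. -/
def balancedMap {R : Type v} [Ring R] (M : Type*) [AddCommGroup M] [Module Rᵐᵒᵖ M]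
    {A B : Type*} [AddCommGroup A] [Module R A] [AddCommGroup B] [Module R B] (f : A →ₗ[R] B) :
    BalancedTensor R M A →+ BalancedTensor R M B :=
  QuotientAddGroup.map _ _ (intTensorMap M f) (balancedRel_le_comap M f)

end Tensor

/-! ### Purity for modules -/

section Modules

/-- A short exact sequence `0 → A → B → C → 0` of left `R`-modules is pure exact if
`0 → M ⊗_R A → M ⊗_R B → M ⊗_R C → 0` is exact for every right `R`-module `M`. -/
def IsPureShortExact {R : Type v} [Ring R] (S : ShortComplex (ModuleCat.{u} R)) : Prop :=
  S.ShortExact ∧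
    ∀ (M : Type (max u v)) [AddCommGroup M] [Module Rᵐᵒᵖ M],
      Function.Injective (balancedMap M S.f.hom) ∧
      Function.Exact (balancedMap M S.f.hom) (balancedMap M S.g.hom) ∧
      Function.Surjective (balancedMap M S.g.hom)

/-- `f : A → B` is pure monic if it is the first map of a pure exact sequence
`0 → A → B → C → 0`. -/
def IsPureMonic {R : Type v} [Ring R] {A B : ModuleCat.{u} R} (f : A ⟶ B) : Prop :=
  ∃ (C : ModuleCat.{u} R) (g : B ⟶ C) (w : f ≫ g = 0), IsPureShortExact (ShortComplex.mk f g w)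

/-- `g : B → C` is pure epic if it is the second map of a pure exact sequence
`0 → A → B → C → 0`. -/
def IsPureEpic {R : Type v} [Ring R] {B C : ModuleCat.{u} R} (g : B ⟶ C) : Prop :=
  ∃ (A : ModuleCat.{u} R) (f : A ⟶ B) (w : f ≫ g = 0), IsPureShortExact (ShortComplex.mk f g w)

/-- A module `P` is pure projective if it is projective with respect to pure exact sequences:
every map from `P` to the last term of a pure exact sequence `0 → A → B → C → 0` lifts to `B`. -/
def IsPureProjective {R : Type v} [Ring R] (P : ModuleCat.{u} R) : Prop :=
  ∀ S : ShortComplex (ModuleCat.{u} R), IsPureShortExact S →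
    ∀ h : P ⟶ S.X₃, ∃ l : P ⟶ S.X₂, l ≫ S.g = h

end Modules

/-! ### Purity for complexes (with cohomological indexing) -/

section Complexes

/-- A map decomposes if it is a pure epic map followed by a pure monic map. -/
def Decomposes {R : Type v} [Ring R] {A B : ModuleCat.{u} R} (d : A ⟶ B) : Prop :=
  ∃ (D : ModuleCat.{u} R) (p : A ⟶ D) (i : D ⟶ B), IsPureEpic p ∧ IsPureMonic i ∧ p ≫ i = d

/-- The complex `X` is pure exact at `n` if `d^{n-1}` and `d^n` decompose and the sequence
`0 → Ker d^n → X^n → Coker d^{n-1} → 0` is (a complex and) pure exact. -/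
def IsPureExactAt {R : Type v} [Ring R] (X : CochainComplex (ModuleCat.{u} R) ℤ) (n : ℤ) : Prop :=
  Decomposes (X.d (n - 1) n) ∧ Decomposes (X.d n (n + 1)) ∧
    ∃ w : kernel.ι (X.d n (n + 1)) ≫ cokernel.π (X.d (n - 1) n) = 0,
      IsPureShortExact
        (ShortComplex.mk (kernel.ι (X.d n (n + 1))) (cokernel.π (X.d (n - 1) n)) w)

/-- The complex `X` is pure exact if it is pure exact at every `n`. -/
def IsPureExact {R : Type v} [Ring R] (X : CochainComplex (ModuleCat.{u} R) ℤ) : Prop :=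
  ∀ n : ℤ, IsPureExactAt X n

/-- A cochain map is a pure quasi-isomorphism if its mapping cone is pure exact. -/
def IsPureQuasiIso {R : Type v} [Ring R] {X Y : CochainComplex (ModuleCat.{u} R) ℤ}
    (f : X ⟶ Y) : Prop :=
  IsPureExact (CochainComplex.mappingCone f)

/-- The total complex `Hom_R(X, Y)` of `ℤ`-modules, with `∏ i, Hom_R(X^i, Y^{i+n})` in degree `n`
and differential `φ ↦ d_Y ∘ φ - (-1)^n φ ∘ d_X`. -/
noncomputable def homComplex {R : Type v} [Ring R] (X Y : CochainComplex (ModuleCat.{u} R) ℤ) :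
    CochainComplex (ModuleCat.{u} ℤ) ℤ where
  X n := ModuleCat.of ℤ (CochainComplex.HomComplex.Cochain X Y n)
  d n m := ModuleCat.ofHom (CochainComplex.HomComplex.δ_hom ℤ X Y n m)
  shape n m h :=
    ModuleCat.hom_ext (LinearMap.ext fun z => CochainComplex.HomComplex.δ_shape n m h z)
  d_comp_d' n m k _ _ :=
    ModuleCat.hom_ext (LinearMap.ext fun z => CochainComplex.HomComplex.δ_δ n m k z)

/-- `f : P → X` is a pure projective resolution of `X` if `P` consists of pure projective modules,
`f` is a pure quasi-isomorphism, and `Hom_R(P, -)` takes pure exact complexes of `R`-modules to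
pure exact complexes of `ℤ`-modules. -/
structure IsPureProjectiveResolution {R : Type v} [Ring R]
    {P X : CochainComplex (ModuleCat.{u} R) ℤ} (f : P ⟶ X) : Prop where
  pureProjective : ∀ i : ℤ, IsPureProjective (P.X i)
  pureQuasiIso : IsPureQuasiIso f
  preserves : ∀ Y : CochainComplex (ModuleCat.{u} R) ℤ, IsPureExact Y →
    IsPureExact (homComplex P Y)

end Complexes

end PureComplex

/-! Purity is a statement about linear equations. A short exact sequence is pure exactly when every
finite linear system with constants in the submodule that is solvable in the middle term is solvable
in the submodule (`isPureShortExact_of_isSystemPure`, `IsPureShortExact.isSystemPure`); finite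
homogeneous systems then lift along the epimorphism. Hence a complex is pure exact iff every tuple
of cycles solving a finite homogeneous system bounds a tuple solving the same system
(`IsPureExact.isLinearlyExact`, `IsLinearlyExact.isPureExact`). Such a tuple is a map from a
finitely presented module, and these modules are pure projective.

The resolution is a cellular construction. For every map from a finitely presented module to the
cycles of `X`, attach a copy of that module as a cell bounding the map, and repeat countably often.
A finite tuple of cycles in the union lies in some stage and bounds in the next one, so the union is
pure exact. As a complex the union is the cone of a map `P → X`, where `P` consists of all attached
cells, so its terms are direct sums of finitely presented modules.

The differential of `P` sends the cells of stage `k` to cells of earlier stages. A cocycle from `P`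
to a pure exact `Y` can therefore be made a coboundary one stage at a time
(`IsCellular.exists_δ_eq`), so `Hom(P, Y)` is exact. It is even pure exact, because solving integral
equations in `Hom(P, Y)` means mapping `P` to the complex of solutions in `Y`, which is again pure
exact (`isPureExact_homComplex`). -/

open scoped DirectSum

namespace PureComplex

/-! ### Right exactness of the tensor product over a noncommutative ring. -/

section BalancedTensor

variable {R : Type v} [Ring R] {M : Type*} [AddCommGroup M] [Module Rᵐᵒᵖ M]
  {A B C : Type*} [AddCommGroup A] [Module R A] [AddCommGroup B] [Module R B]
  [AddCommGroup C] [Module R C]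

variable (R) in
/-- The elementary tensor `x ⊗ a` in `M ⊗_R A`. -/
def balancedTmul : M →+ A →+ BalancedTensor R M A where
  toFun x := (QuotientAddGroup.mk' (balancedRel R M A)).comp
    (TensorProduct.mk ℤ M A x).toAddMonoidHom
  map_zero' := by ext; simp
  map_add' x y := by ext; simp

theorem balancedTmul_smul (x : M) (r : R) (a : A) :
    balancedTmul R x (r • a) = balancedTmul R (MulOpposite.op r • x) a := by
  refine (QuotientAddGroup.eq.2 ?_)
  refine AddSubgroup.subset_closure ⟨x, r, a, ?_⟩
  rw [neg_add_eq_sub]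
  rfl

@[simp]
theorem balancedMap_tmul (f : A →ₗ[R] B) (x : M) (a : A) :
    balancedMap M f (balancedTmul R x a) = balancedTmul R x (f a) :=
  rfl

theorem exists_sum_balancedTmul (t : BalancedTensor R M A) :
    ∃ (n : ℕ) (x : Fin n → M) (a : Fin n → A), t = ∑ i, balancedTmul R (x i) (a i) := by
  obtain ⟨t, rfl⟩ := QuotientAddGroup.mk'_surjective _ t
  induction t using TensorProduct.induction_on with
  | zero => exact ⟨0, Fin.elim0, Fin.elim0, by simp⟩
  | tmul x a => exact ⟨1, fun _ => x, fun _ => a, by simp; rfl⟩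
  | add s t hs ht =>
    obtain ⟨n, x, a, hs⟩ := hs
    obtain ⟨m, y, b, ht⟩ := ht
    refine ⟨n + m, Fin.append x y, Fin.append a b, ?_⟩
    rw [map_add, hs, ht, Fin.sum_univ_add]
    simp

/-- The map out of `M ⊗_R A` induced by a balanced biadditive map. -/
def balancedLift {T : Type*} [AddCommGroup T] (φ : M →+ A →+ T)
    (hφ : ∀ x (r : R) a, φ (MulOpposite.op r • x) a = φ x (r • a)) :
    BalancedTensor R M A →+ T :=
  QuotientAddGroup.lift _
    (TensorProduct.liftAddHom φ fun n x a => by simp [map_zsmul])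
    (by
      rw [balancedRel, AddSubgroup.closure_le]
      rintro _ ⟨x, r, a, rfl⟩
      simp [hφ])

@[simp]
theorem balancedLift_tmul {T : Type*} [AddCommGroup T] (φ : M →+ A →+ T)
    (hφ : ∀ x (r : R) a, φ (MulOpposite.op r • x) a = φ x (r • a)) (x : M) (a : A) :
    balancedLift φ hφ (balancedTmul R x a) = φ x a :=
  rfl

theorem balancedMap_surjective {g : B →ₗ[R] C} (hg : Function.Surjective g) :
    Function.Surjective (balancedMap M g) := by
  intro t
  obtain ⟨n, x, c, rfl⟩ := exists_sum_balancedTmul t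
  choose b hb using fun i => hg (c i)
  exact ⟨∑ i, balancedTmul R (x i) (b i), by simp [hb]⟩

/-- Choosing preimages under `g` gives a balanced map from `M × C` to the cokernel of `M ⊗ f`, well
defined because the choice matters only up to the image of `f`. Composed with `M ⊗ g` it is the
quotient map, so the kernel of `M ⊗ g` lies in the image of `M ⊗ f`. -/
theorem balancedMap_exact {f : A →ₗ[R] B} {g : B →ₗ[R] C} (hfg : Function.Exact f g)
    (hg : Function.Surjective g) :
    Function.Exact (balancedMap M f) (balancedMap M g) := by
  intro t
  constructor
  · intro ht
    let q := QuotientAddGroup.mk' (balancedMap M f).range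
    have hker (x : M) : g.toAddMonoidHom.ker ≤ (q.comp (balancedTmul R x)).ker := by
      intro b hb
      obtain ⟨a, rfl⟩ := (hfg b).1 hb
      exact (QuotientAddGroup.eq_zero_iff _).2 ⟨balancedTmul R x a, rfl⟩
    let lft (x : M) : C →+ _ :=
      g.toAddMonoidHom.liftOfSurjective hg ⟨q.comp (balancedTmul R x), hker x⟩
    have lft_apply (x : M) (b : B) : lft x (g b) = q (balancedTmul R x b) :=
      g.toAddMonoidHom.liftOfRightInverse_comp_apply _ _ _ b
    let φ : M →+ C →+ BalancedTensor R M B ⧸ (balancedMap M f).range :=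
      AddMonoidHom.mk' lft fun x y => by
        ext c
        obtain ⟨b, rfl⟩ := hg c
        simp [lft_apply]
    have hφ : ∀ x (r : R) c, φ (MulOpposite.op r • x) c = φ x (r • c) := by
      intro x r c
      obtain ⟨b, rfl⟩ := hg c
      change lft _ _ = lft _ _
      rw [← map_smul, lft_apply, lft_apply, balancedTmul_smul]
    have key : (balancedLift φ hφ) (balancedMap M g t) = q t := by
      obtain ⟨n, x, b, rfl⟩ := exists_sum_balancedTmul t
      simp only [map_sum, balancedMap_tmul, balancedLift_tmul]
      exact Finset.sum_congr rfl fun i _ => lft_apply _ _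
    rw [ht, map_zero] at key
    exact (QuotientAddGroup.eq_zero_iff t).1 key.symm
  · rintro ⟨s, rfl⟩
    obtain ⟨n, x, a, rfl⟩ := exists_sum_balancedTmul s
    simp [hfg.apply_apply_eq_zero]

end BalancedTensor

/-! ### Purity as solvability of finite linear systems. -/

section Systems

variable {R : Type v} [Ring R] {A B C : Type*} [AddCommGroup A] [Module R A] [AddCommGroup B]
  [Module R B] [AddCommGroup C] [Module R C]

/-- Every finite system of linear equations with constants in `A` that is solvable in `B` is
solvable in `A`. -/
def IsSystemPure (f : A →ₗ[R] B) : Prop :=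
  ∀ (ι κ : Type) [Fintype ι] [Fintype κ] (r : ι → κ → R) (a : ι → A) (b : κ → B),
    (∀ i, f (a i) = ∑ j, r i j • b j) → ∃ a' : κ → A, ∀ i, a i = ∑ j, r i j • a' j

/-- Arbitrary lifts of a solution fail the equations by constants from `A`; solving the system with
these constants inside `A` gives the correction. -/
theorem IsSystemPure.exists_lift {f : A →ₗ[R] B} {g : B →ₗ[R] C} (hf : IsSystemPure f)
    (hfg : Function.Exact f g) (hg : Function.Surjective g)
    {ι κ : Type} [Fintype ι] [Fintype κ] (r : ι → κ → R) (c : κ → C)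
    (hc : ∀ i, ∑ j, r i j • c j = 0) :
    ∃ b : κ → B, (∀ j, g (b j) = c j) ∧ ∀ i, ∑ j, r i j • b j = 0 := by
  choose b hb using fun j => hg (c j)
  have h (i) : ∃ a, f a = ∑ j, r i j • b j := by
    refine (hfg _).1 ?_
    simp [hb, hc]
  choose a ha using h
  obtain ⟨a', ha'⟩ := hf ι κ r a b ha
  refine ⟨fun j => b j - f (a' j), fun j => ?_, fun i => ?_⟩
  · simp [hb, hfg.apply_apply_eq_zero]
  · simp [smul_sub, ← ha, ha' i]

theorem IsSystemPure.injective_balancedMap {f : A →ₗ[R] B} (hf : IsSystemPure f)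
    (M : Type*) [AddCommGroup M] [Module Rᵐᵒᵖ M] :
    Function.Injective (balancedMap M f) := by
  classical
  rw [injective_iff_map_eq_zero]
  intro t ht
  obtain ⟨n, x, a, rfl⟩ := exists_sum_balancedTmul t
  -- Relations among the tensors are read off from the free presentation of `B` on its underlying
  -- set: a tensor that vanishes over `B` comes from the kernel of `π`.
  let π : (B →₀ R) →ₗ[R] B := Finsupp.linearCombination R id
  have hπ : Function.Surjective π := fun b => ⟨Finsupp.single b 1, by simp [π]⟩
  have hex : Function.Exact (LinearMap.ker π).subtype π := LinearMap.exact_subtype_ker_map π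
  let g (i : Fin n) : B →₀ R := Finsupp.single (f (a i)) 1
  have hg (i) : π (g i) = f (a i) := by simp [π, g]
  obtain ⟨s, hs⟩ := (balancedMap_exact (M := M) (A := LinearMap.ker π) hex hπ
    (∑ i, balancedTmul R (x i) (g i))).1 (by
    simpa [hg] using ht)
  obtain ⟨m, y, k, rfl⟩ := exists_sum_balancedTmul s
  -- `ev b` is the coefficient at the basis element `b`; applying it to `hs` compares coefficients
  -- of the two tensors.
  let ev (b : B) : BalancedTensor R M (B →₀ R) →+ M :=
    balancedLift (AddMonoidHom.mk' (fun x => AddMonoidHom.mk' (fun c => MulOpposite.op (c b) • x)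
      (by intros; simp [add_smul])) (by intros; ext; simp)) (by intros; simp [mul_smul])
  have hev (b : B) :
      ∑ l, MulOpposite.op ((k l).1 b) • y l = ∑ i, MulOpposite.op (g i b) • x i := by
    simpa [ev] using congrArg (ev b) hs
  let S : Finset B := (Finset.univ.biUnion fun i => (g i).support) ∪
    (Finset.univ.biUnion fun l => (k l).1.support)
  let e : Fin S.card → B := fun j => (S.equivFin.symm j).1
  have hsum (c : B →₀ R) (hc : c.support ⊆ S) : π c = ∑ j, c (e j) • e j := by
    rw [Equiv.sum_comp S.equivFin.symm (fun b : S => c b.1 • b.1),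
      Finset.sum_coe_sort S (fun b => c b • b)]
    exact Finsupp.sum_of_support_subset c hc _ (by simp)
  have hgS (i) : (g i).support ⊆ S := fun b hb =>
    Finset.mem_union_left _ (Finset.mem_biUnion.2 ⟨i, Finset.mem_univ _, hb⟩)
  have hkS (l) : (k l).1.support ⊆ S := fun b hb =>
    Finset.mem_union_right _ (Finset.mem_biUnion.2 ⟨l, Finset.mem_univ _, hb⟩)
  -- The system has one equation for each `a i`, and one with constant zero for each kernel element
  -- `k l`. The elements of `S` solve it in `B`.
  obtain ⟨a', ha'⟩ := hf (Fin n ⊕ Fin m) (Fin S.card)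
    (Sum.elim (fun i j => g i (e j)) (fun l j => (k l).1 (e j)))
    (Sum.elim a 0) e (by
      rintro (i | l)
      · simpa [hg] using hsum (g i) (hgS i)
      · have := hsum _ (hkS l)
        rw [LinearMap.mem_ker.1 (k l).2] at this
        simpa using this)
  have h₁ (i) : a i = ∑ j, g i (e j) • a' j := ha' (Sum.inl i)
  have h₂ (l) : ∑ j, (k l).1 (e j) • a' j = 0 := (ha' (Sum.inr l)).symm
  calc ∑ i, balancedTmul R (x i) (a i)
      = ∑ i, ∑ j, balancedTmul R (MulOpposite.op (g i (e j)) • x i) (a' j) := by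
        refine Finset.sum_congr rfl fun i _ => ?_
        rw [h₁ i, map_sum]
        simp only [balancedTmul_smul]
    _ = ∑ j, balancedTmul R (∑ i, MulOpposite.op (g i (e j)) • x i) (a' j) := by
        rw [Finset.sum_comm]
        simp
    _ = ∑ l, ∑ j, balancedTmul R (MulOpposite.op ((k l).1 (e j)) • y l) (a' j) := by
        simp only [← hev]
        rw [Finset.sum_comm]
        simp
    _ = ∑ l, balancedTmul R (y l) (∑ j, (k l).1 (e j) • a' j) := by
        simp only [map_sum, balancedTmul_smul]
    _ = 0 := by simp [h₂]

theorem isPureShortExact_of_isSystemPure {S : ShortComplex (ModuleCat.{u} R)}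
    (hS : S.ShortExact) (h : IsSystemPure S.f.hom) : IsPureShortExact S := by
  have hg : Function.Surjective S.g.hom := hS.moduleCat_surjective_g
  have hfg : Function.Exact S.f.hom S.g.hom :=
    (ShortComplex.ShortExact.moduleCat_exact_iff_function_exact S).1 hS.exact
  exact ⟨hS, fun M _ _ => ⟨h.injective_balancedMap M, balancedMap_exact hfg hg,
    balancedMap_surjective hg⟩⟩

end Systems

/-- The test module is the right module presented by the coefficient matrix, that is, `R^ι` modulo
the columns. Tensoring it with `A` maps to `A^ι` modulo the right-hand sides solvable in `A`, so `∑
e i ⊗ a i = 0` forces the system to be solvable in `A`. -/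
theorem isSystemPure_of_injective_balancedMap {R : Type u} [Ring R] {A B : Type*}
    [AddCommGroup A] [Module R A] [AddCommGroup B] [Module R B] {f : A →ₗ[R] B}
    (hf : ∀ (M : Type u) [AddCommGroup M] [Module Rᵐᵒᵖ M], Function.Injective (balancedMap M f)) :
    IsSystemPure f := by
  classical
  intro ι κ _ _ r a b hab
  let N : Submodule Rᵐᵒᵖ (ι → R) := Submodule.span Rᵐᵒᵖ (Set.range fun j i => r i j)
  let L : AddSubgroup (ι → A) := (AddMonoidHom.mk' (fun (c : κ → A) i => ∑ j, r i j • c j) (by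
    intros; ext; simp [Finset.sum_add_distrib])).range
  have memL (v : ι → A) : v ∈ L ↔ ∃ c : κ → A, (fun i => ∑ j, r i j • c j) = v := Iff.rfl
  let φ₀ : (ι → R) →+ A →+ (ι → A) ⧸ L :=
    AddMonoidHom.mk' (fun v => (QuotientAddGroup.mk' L).comp
      (AddMonoidHom.mk' (fun c i => v i • c) (by intros; ext; simp))) (by
        intro v w
        ext c
        simp only [AddMonoidHom.comp_apply, AddMonoidHom.add_apply, ← map_add]
        congr 1
        ext i
        simp [add_smul])
  have φ₀_apply (v c) : φ₀ v c = QuotientAddGroup.mk' L (fun i => v i • c) := rfl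
  have hN : N.mkQ.toAddMonoidHom.ker ≤ φ₀.ker := by
    intro v hv
    replace hv : v ∈ N := by simpa using hv
    rw [AddMonoidHom.mem_ker]
    ext c
    induction hv using Submodule.span_induction generalizing c with
    | mem v hv =>
      obtain ⟨j, rfl⟩ := hv
      refine (QuotientAddGroup.eq_zero_iff _).2 ((memL _).2 ⟨Pi.single j c, ?_⟩)
      ext i
      rw [Finset.sum_eq_single j] <;> simp +contextual
    | zero => simp
    | add v w _ _ hv hw => simp [hv, hw]
    | smul s v _ hv =>
      have := hv (s.unop • c)
      rw [φ₀_apply] at this ⊢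
      rw [AddMonoidHom.zero_apply] at this ⊢
      rw [← this]
      congr 1
      ext i
      simp [smul_smul]
  let φ : ((ι → R) ⧸ N) →+ A →+ (ι → A) ⧸ L :=
    N.mkQ.toAddMonoidHom.liftOfSurjective N.mkQ_surjective ⟨φ₀, hN⟩
  have φ_apply (v : ι → R) : φ (N.mkQ v) = φ₀ v :=
    N.mkQ.toAddMonoidHom.liftOfRightInverse_comp_apply _ _ _ v
  have hφ : ∀ x (s : R) c, φ (MulOpposite.op s • x) c = φ x (s • c) := by
    intro x s c
    obtain ⟨v, rfl⟩ := N.mkQ_surjective x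
    rw [← map_smul, φ_apply, φ_apply, φ₀_apply, φ₀_apply]
    congr 1
    ext i
    simp [smul_smul]
  let e (i : ι) : (ι → R) ⧸ N := N.mkQ (Pi.single i 1)
  have hzero : ∑ i, balancedTmul R (e i) (a i) = 0 := by
    refine (injective_iff_map_eq_zero _).1 (hf ((ι → R) ⧸ N)) _ ?_
    -- After applying `f`, moving the coefficients across the tensor sign leaves the columns of the
    -- matrix on the left, and these are zero in the quotient.
    simp only [map_sum, balancedMap_tmul, hab, balancedTmul_smul]
    rw [Finset.sum_comm]
    refine Finset.sum_eq_zero fun j _ => ?_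
    have : ∑ i, MulOpposite.op (r i j) • e i = 0 := by
      simp only [e, ← map_smul, ← map_sum]
      rw [Submodule.mkQ_apply, Submodule.Quotient.mk_eq_zero]
      refine Submodule.subset_span ⟨j, ?_⟩
      ext i
      simp [Finset.sum_apply, Pi.single_apply]
    have h' := congrArg (fun x => balancedTmul R x (b j)) this
    simpa using h'
  have := congrArg (balancedLift φ hφ) hzero
  simp only [map_sum, balancedLift_tmul, e, φ_apply, φ₀_apply, map_zero] at this
  rw [← map_sum] at this
  obtain ⟨a', ha'⟩ := (memL _).1 ((QuotientAddGroup.eq_zero_iff _).1 this)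
  refine ⟨a', fun i => ?_⟩
  have := congrFun ha' i
  rw [this]
  simp [Finset.sum_apply, Pi.single_apply]

theorem IsPureShortExact.isSystemPure {R : Type u} [Ring R] {S : ShortComplex (ModuleCat.{u} R)}
    (hS : IsPureShortExact S) : IsSystemPure S.f.hom :=
  isSystemPure_of_injective_balancedMap fun M _ _ => (hS.2 M).1

/-! ### Pure exactness of complexes through linear systems. -/

/-- The complex `X` is exact, and every tuple of cycles satisfying a finite system of homogeneous
linear equations is the boundary of a tuple satisfying the same system. -/
def IsLinearlyExact {R : Type v} [Ring R] (X : CochainComplex (ModuleCat.{u} R) ℤ) : Prop :=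
  ∀ (i j k : ℤ), i + 1 = j → j + 1 = k →
    ∀ (ι κ : Type) [Fintype ι] [Fintype κ] (r : ι → κ → R) (x : κ → X.X j),
      (∀ b, (X.d j k).hom (x b) = 0) → (∀ a, ∑ b, r a b • x b = 0) →
      ∃ w : κ → X.X i, (∀ b, (X.d i j).hom (w b) = x b) ∧ ∀ a, ∑ b, r a b • w b = 0

theorem IsPureEpic.exists_lift {R : Type u} [Ring R] {B C : ModuleCat.{u} R} {p : B ⟶ C}
    (hp : IsPureEpic p) {ι κ : Type} [Fintype ι] [Fintype κ] (r : ι → κ → R) (c : κ → C)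
    (hc : ∀ i, ∑ j, r i j • c j = 0) :
    ∃ b : κ → B, (∀ j, p.hom (b j) = c j) ∧ ∀ i, ∑ j, r i j • b j = 0 := by
  obtain ⟨A, f, w, hS⟩ := hp
  exact hS.isSystemPure.exists_lift
    ((ShortComplex.ShortExact.moduleCat_exact_iff_function_exact _).1 hS.1.exact)
    hS.1.moduleCat_surjective_g r c hc

section PureExact

variable {R : Type v} [Ring R] {X : CochainComplex (ModuleCat.{u} R) ℤ}

theorem IsPureExactAt.exists_d_eq {j k : ℤ} (h : IsPureExactAt X j) (hjk : j + 1 = k)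
    (x : X.X j) (hx : (X.d j k).hom x = 0) :
    ∃ w : X.X (j - 1), (X.d (j - 1) j).hom w = x := by
  subst hjk
  obtain ⟨-, -, w, -⟩ := h
  let ζ : ModuleCat.of R (LinearMap.ker (X.d j (j + 1)).hom) ⟶ X.X j :=
    ModuleCat.ofHom (Submodule.subtype _)
  have hζ : ζ ≫ X.d j (j + 1) = 0 := by
    ext y
    exact y.2
  have h0 : ζ ≫ cokernel.π (X.d (j - 1) j) = 0 := by
    rw [← kernel.lift_ι (X.d j (j + 1)) ζ hζ, Category.assoc, w, comp_zero]
  have hx0 : (cokernel.π (X.d (j - 1) j)).hom x = 0 :=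
    congrArg (fun φ => φ.hom (⟨x, hx⟩ : LinearMap.ker (X.d j (j + 1)).hom)) h0
  exact ((ShortComplex.ShortExact.moduleCat_exact_iff_function_exact _).1
    (ShortComplex.exact_cokernel (X.d (j - 1) j)) x).1 hx0

/-- The factorization of a differential of a pure exact complex through its cycles. -/
theorem IsPureExact.exists_factorization (h : IsPureExact X) {i j k : ℤ} (hij : i + 1 = j)
    (hjk : j + 1 = k) :
    ∃ (D : ModuleCat.{u} R) (p : X.X i ⟶ D) (m : D ⟶ X.X j), IsPureEpic p ∧
      Function.Injective m.hom ∧ p ≫ m = X.d i j ∧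
      ∀ x, (X.d j k).hom x = 0 → ∃ y, m.hom y = x := by
  obtain rfl : i = j - 1 := by lia
  obtain ⟨D, p, m, hp, ⟨C, g, w, hm⟩, hpm⟩ := (h j).1
  refine ⟨D, p, m, hp, hm.1.moduleCat_injective_f, hpm, fun x hx => ?_⟩
  obtain ⟨y, hy⟩ := (h j).exists_d_eq hjk x hx
  refine ⟨p.hom y, ?_⟩
  rw [← hy, ← hpm]
  rfl

theorem IsLinearlyExact.exists_d_eq (h : IsLinearlyExact X) {i j k : ℤ} (hij : i + 1 = j)
    (hjk : j + 1 = k) (x : X.X j) (hx : (X.d j k).hom x = 0) :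
    ∃ w : X.X i, (X.d i j).hom w = x := by
  -- Ordinary exactness is the case of one unknown and no equations.
  obtain ⟨w, hw, -⟩ := h i j k hij hjk Empty Unit (fun a => a.elim) (fun _ => x) (fun _ => hx)
    (fun a => a.elim)
  exact ⟨w (), hw ()⟩

/-- This shows that cycles form a pure submodule. If `b` solves a system with constants in the
cycles, the boundaries of `b` solve the homogeneous system; lifting them to a homogeneous solution
`w`, the difference `b - w` consists of cycles and solves the original system. -/
theorem IsLinearlyExact.isSystemPure (h : IsLinearlyExact X) {j k l : ℤ} (hjk : j + 1 = k)
    (hkl : k + 1 = l) {A : Type*} [AddCommGroup A] [Module R A] {f : A →ₗ[R] X.X j}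
    (hf : Function.Injective f) (hex : Function.Exact f (X.d j k).hom) :
    IsSystemPure f := by
  intro ι κ _ _ r a b hab
  have hdd (x : X.X j) : (X.d k l).hom ((X.d j k).hom x) = 0 := by
    rw [← LinearMap.comp_apply, ← ModuleCat.hom_comp, X.d_comp_d]
    rfl
  obtain ⟨w, hw, hrw⟩ := h j k l hjk hkl ι κ r (fun s => (X.d j k).hom (b s)) (fun _ => hdd _)
    (fun i => by
      simp only [← map_smul, ← map_sum, ← hab]
      exact hex.apply_apply_eq_zero _)
  have hz (s) : ∃ z, f z = b s - w s := (hex _).1 (by simp [hw])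
  choose z hz using hz
  refine ⟨z, fun i => hf ?_⟩
  simp [hz, smul_sub, hab, hrw]

theorem IsLinearlyExact.decomposes (h : IsLinearlyExact X) {i j : ℤ} (hij : i + 1 = j) :
    Decomposes (X.d i j) := by
  have hdd (x : X.X i) : (X.d j (j + 1)).hom ((X.d i j).hom x) = 0 := by
    rw [← LinearMap.comp_apply, ← ModuleCat.hom_comp, X.d_comp_d]
    rfl
  let Z := LinearMap.ker (X.d j (j + 1)).hom
  let p : X.X i →ₗ[R] Z := (X.d i j).hom.codRestrict Z hdd
  have hp : Function.Surjective p := by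
    rintro ⟨x, hx⟩
    obtain ⟨w, hw⟩ := h.exists_d_eq hij rfl x hx
    exact ⟨w, Subtype.ext hw⟩
  have hker : LinearMap.ker p = LinearMap.ker (X.d i j).hom := LinearMap.ker_codRestrict ..
  refine ⟨ModuleCat.of R Z, ModuleCat.ofHom p, ModuleCat.ofHom Z.subtype,
    ⟨ModuleCat.of R (LinearMap.ker p), ModuleCat.ofHom (LinearMap.ker p).subtype, ?_, ?_⟩,
    ⟨ModuleCat.of R (X.X j ⧸ Z), ModuleCat.ofHom Z.mkQ, ?_, ?_⟩, rfl⟩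
  · ext x
    exact congrArg Subtype.val (LinearMap.mem_ker.1 x.2)
  · refine isPureShortExact_of_isSystemPure ?_ ?_
    · exact ShortComplex.ShortExact.mk' (by
        rw [ShortComplex.ShortExact.moduleCat_exact_iff_function_exact]
        exact LinearMap.exact_subtype_ker_map p)
        ((ModuleCat.mono_iff_injective _).2 (Submodule.subtype_injective _))
        ((ModuleCat.epi_iff_surjective _).2 hp)
    · refine h.isSystemPure hij rfl (Submodule.subtype_injective _) ?_
      intro x
      rw [← LinearMap.mem_ker, ← hker]
      exact ⟨fun hx => ⟨⟨x, hx⟩, rfl⟩, by rintro ⟨y, rfl⟩; exact y.2⟩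
  · ext x
    exact (Submodule.Quotient.mk_eq_zero _).2 x.2
  · refine isPureShortExact_of_isSystemPure ?_ ?_
    · exact ShortComplex.ShortExact.mk' (by
        rw [ShortComplex.ShortExact.moduleCat_exact_iff_function_exact]
        exact LinearMap.exact_subtype_mkQ Z)
        ((ModuleCat.mono_iff_injective _).2 (Submodule.subtype_injective _))
        ((ModuleCat.epi_iff_surjective _).2 Z.mkQ_surjective)
    · exact h.isSystemPure rfl rfl (Submodule.subtype_injective _)
        (LinearMap.exact_subtype_ker_map _)

/-- By exactness the kernel of one differential is the image of the previous one, so every sequence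
required for pure exactness begins with a module of cycles, and `IsLinearlyExact.isSystemPure`
applies. -/
theorem IsLinearlyExact.isPureExact (h : IsLinearlyExact X) : IsPureExact X := by
  intro n
  have hn : n - 1 + 1 = n := by lia
  have hcok : Function.Exact (X.d (n - 1) n).hom (cokernel.π (X.d (n - 1) n)).hom :=
    (ShortComplex.ShortExact.moduleCat_exact_iff_function_exact _).1
      (ShortComplex.exact_cokernel (X.d (n - 1) n))
  have hker : Function.Exact (kernel.ι (X.d n (n + 1))).hom (X.d n (n + 1)).hom :=
    (ShortComplex.ShortExact.moduleCat_exact_iff_function_exact _).1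
      (ShortComplex.exact_kernel (X.d n (n + 1)))
  have hd : Function.Exact (X.d (n - 1) n).hom (X.d n (n + 1)).hom := by
    intro x
    refine ⟨fun hx => h.exists_d_eq hn rfl x hx, ?_⟩
    rintro ⟨w, rfl⟩
    rw [← LinearMap.comp_apply, ← ModuleCat.hom_comp, X.d_comp_d]
    rfl
  have hex : Function.Exact (kernel.ι (X.d n (n + 1))).hom (cokernel.π (X.d (n - 1) n)).hom :=
    fun x => ((hcok x).trans (hd x).symm).trans (hker x)
  have w : kernel.ι (X.d n (n + 1)) ≫ cokernel.π (X.d (n - 1) n) = 0 := by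
    ext x
    exact hex.apply_apply_eq_zero x
  refine ⟨h.decomposes hn, h.decomposes rfl, w, isPureShortExact_of_isSystemPure ?_ ?_⟩
  · exact ShortComplex.ShortExact.mk' (by
      rw [ShortComplex.ShortExact.moduleCat_exact_iff_function_exact]
      exact hex) inferInstance inferInstance
  · exact h.isSystemPure rfl rfl ((ModuleCat.mono_iff_injective _).1 inferInstance) hker

end PureExact

theorem IsPureExact.isLinearlyExact {R : Type u} [Ring R]
    {X : CochainComplex (ModuleCat.{u} R) ℤ} (h : IsPureExact X) : IsLinearlyExact X := by
  intro i j k hij hjk ι κ _ _ r x hx hrx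
  obtain ⟨D, p, m, hp, hm, hpm, hcyc⟩ := h.exists_factorization hij hjk
  choose v hv using fun b => hcyc (x b) (hx b)
  obtain ⟨w, hw, hrw⟩ := hp.exists_lift r v (fun a => hm (by simp [hv, hrx]))
  refine ⟨w, fun b => ?_, hrw⟩
  rw [← hpm, ModuleCat.hom_comp, LinearMap.comp_apply, hw, hv]

/-! ### Finitely presented modules and their direct sums are pure projective. -/

/-- A finite system of homogeneous linear equations over `R`. -/
structure LinearSystem (R : Type u) where
  /-- The number of equations. -/
  rows : ℕ
  /-- The number of unknowns. -/
  cols : ℕ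
  /-- The coefficients. -/
  coeff : Fin rows → Fin cols → R

namespace LinearSystem

variable {R : Type u} [Ring R] (s : LinearSystem R)

/-- The finitely presented module representing the solutions of the system `s`. -/
abbrev Mod : Type u := (Fin s.cols → R) ⧸ Submodule.span R (Set.range s.coeff)

/-- The universal solution of the system `s`. -/
def gen (j : Fin s.cols) : s.Mod := Submodule.mkQ _ (Pi.single j 1)

theorem sum_smul_gen (i : Fin s.rows) : ∑ j, s.coeff i j • s.gen j = 0 := by
  simp only [gen, ← map_smul, ← map_sum]
  rw [Submodule.mkQ_apply, Submodule.Quotient.mk_eq_zero]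
  refine Submodule.subset_span ⟨i, ?_⟩
  ext j
  simp [Finset.sum_apply, Pi.single_apply]

variable {s} {N : Type*} [AddCommGroup N] [Module R N]

/-- The linear map out of `s.Mod` given by a solution of the system `s`. -/
def desc (x : Fin s.cols → N) (hx : ∀ i, ∑ j, s.coeff i j • x j = 0) : s.Mod →ₗ[R] N :=
  Submodule.liftQ _ (Fintype.linearCombination R x) (by
    rw [Submodule.span_le]
    rintro _ ⟨i, rfl⟩
    simp [Fintype.linearCombination_apply, hx])

@[simp]
theorem desc_gen (x : Fin s.cols → N) (hx : ∀ i, ∑ j, s.coeff i j • x j = 0) (j : Fin s.cols) :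
    desc x hx (s.gen j) = x j := by
  simp [desc, gen]

theorem hom_ext {f g : s.Mod →ₗ[R] N} (h : ∀ j, f (s.gen j) = g (s.gen j)) : f = g := by
  refine Submodule.linearMap_qext _ (LinearMap.pi_ext' fun j => ?_)
  ext
  exact h j

variable (s) in
theorem isPureProjective : IsPureProjective (ModuleCat.of R s.Mod) := by
  intro S hS h
  obtain ⟨b, hb, hrb⟩ := hS.isSystemPure.exists_lift
    ((ShortComplex.ShortExact.moduleCat_exact_iff_function_exact _).1 hS.1.exact)
    hS.1.moduleCat_surjective_g s.coeff (fun j => h.hom (s.gen j))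
    (fun i => by simp only [← map_smul, ← map_sum, sum_smul_gen, map_zero])
  refine ⟨ModuleCat.ofHom (desc b hrb), ModuleCat.hom_ext (hom_ext fun j => ?_)⟩
  simp [hb]

end LinearSystem

theorem isPureProjective_directSum.{w, t, z} {R : Type z} [Ring R] {ι : Type w}
    (Q : ι → Type (max t w)) [∀ i, AddCommGroup (Q i)] [∀ i, Module R (Q i)]
    (hQ : ∀ i, IsPureProjective (ModuleCat.of R (Q i))) :
    IsPureProjective (ModuleCat.of R (⨁ i, Q i)) := by
  classical
  intro S hS h
  choose l hl using fun i => hQ i S hS (ModuleCat.ofHom (DirectSum.lof R ι Q i) ≫ h)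
  refine ⟨ModuleCat.ofHom (DirectSum.toModule R ι _ fun i => (l i).hom), ?_⟩
  refine ModuleCat.hom_ext (DirectSum.linearMap_ext R fun i => ?_)
  ext x
  simpa using congrArg (fun f => f.hom x) (hl i)

/-- Maps from a pure projective module to the cycles of a pure exact complex lift along the
differential. -/
theorem IsPureProjective.exists_comp_d_eq {R : Type v} [Ring R] {Q : ModuleCat.{u} R}
    (hQ : IsPureProjective Q) {Y : CochainComplex (ModuleCat.{u} R) ℤ} (hY : IsPureExact Y)
    {i j k : ℤ} (hij : i + 1 = j) (hjk : j + 1 = k) (z : Q ⟶ Y.X j) (hz : z ≫ Y.d j k = 0) :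
    ∃ l : Q ⟶ Y.X i, l ≫ Y.d i j = z := by
  obtain ⟨D, p, m, ⟨A, f, w, hS⟩, hm, hpm, hcyc⟩ := hY.exists_factorization hij hjk
  choose v hv using fun x => hcyc (z.hom x) (congrArg (fun φ => φ.hom x) hz)
  let z' : Q ⟶ D := ModuleCat.ofHom
    { toFun := v
      map_add' := fun x y => hm (by simp [hv])
      map_smul' := fun r x => hm (by simp [hv]) }
  obtain ⟨l, hl⟩ := hQ _ hS z'
  refine ⟨l, ?_⟩
  rw [← hpm, ← Category.assoc]
  change l ≫ p = z' at hl
  rw [hl]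
  ext x
  exact hv x

/-! ### Attaching cells countably often. -/

/-- A sequence of modules with consecutive differentials composing to zero. -/
structure ModuleSeq (R : Type u) [Ring R] where
  /-- The terms. -/
  X : ℤ → ModuleCat.{u} R
  /-- The differentials. -/
  d : ∀ n, X n →ₗ[R] X (n + 1)
  d_d : ∀ n x, d (n + 1) (d n x) = 0

namespace ModuleSeq

variable {R : Type u} [Ring R] (C : ModuleSeq R)

/-- A cell to be attached to `C` in degree `n - 1`: a finitely presented module together with a
map to the cycles of degree `n`. -/
structure Cell (n : ℤ) where
  /-- The presentation of the cell. -/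
  sys : LinearSystem R
  /-- The attaching map. -/
  att : sys.Mod →ₗ[R] C.X n
  d_att : ∀ q, C.d n (att q) = 0

/-- The sum of all cells with boundary in degree `n`. -/
def Cells (n : ℤ) : Type u := ⨁ c : C.Cell n, c.sys.Mod

noncomputable instance (n : ℤ) : AddCommGroup (C.Cells n) :=
  inferInstanceAs (AddCommGroup (⨁ c : C.Cell n, c.sys.Mod))

noncomputable instance (n : ℤ) : Module R (C.Cells n) :=
  inferInstanceAs (Module R (⨁ c : C.Cell n, c.sys.Mod))

open Classical in
/-- The inclusion of a cell in the sum of all cells. -/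
noncomputable def cellInclusion {n : ℤ} (c : C.Cell n) : c.sys.Mod →ₗ[R] C.Cells n :=
  DirectSum.lof R (C.Cell n) (fun c => c.sys.Mod) c

theorem cells_hom_ext {n : ℤ} {T : Type*} [AddCommGroup T] [Module R T]
    {f g : C.Cells n →ₗ[R] T} (h : ∀ c q, f (C.cellInclusion c q) = g (C.cellInclusion c q)) :
    f = g := by
  classical
  exact DirectSum.linearMap_ext R fun c => LinearMap.ext (h c)

theorem isPureProjective_cells (n : ℤ) : IsPureProjective (ModuleCat.of R (C.Cells n)) :=
  isPureProjective_directSum.{u, u} (fun c : C.Cell n => c.sys.Mod) fun c => c.sys.isPureProjective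

open Classical in
/-- The attaching map of the sum of all cells. -/
noncomputable def attachingMap (n : ℤ) : C.Cells n →ₗ[R] C.X n :=
  DirectSum.toModule R (C.Cell n) _ fun c => c.att

@[simp]
theorem attachingMap_cellInclusion (n : ℤ) (c : C.Cell n) (q : c.sys.Mod) :
    C.attachingMap n (C.cellInclusion c q) = c.att q := by
  classical
  exact DirectSum.toModule_lof (M := fun c : C.Cell n => c.sys.Mod) R c q

theorem d_attachingMap (n : ℤ) (q : C.Cells n) : C.d n (C.attachingMap n q) = 0 := by
  have : C.d n ∘ₗ C.attachingMap n = 0 := C.cells_hom_ext fun c q => by simp [c.d_att]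
  exact LinearMap.congr_fun this q

/-- The result of attaching all cells to `C`. -/
noncomputable def attach : ModuleSeq R where
  X n := ModuleCat.of R (C.X n × C.Cells (n + 1))
  d n := LinearMap.inl R _ _ ∘ₗ LinearMap.coprod (C.d n) (C.attachingMap (n + 1))
  d_d n x := by simp [C.d_d, C.d_attachingMap]

/-- The result of attaching all cells `k` times. -/
noncomputable def stage : ℕ → ModuleSeq R
  | 0 => C
  | k + 1 => (stage k).attach

/-- The sum of all cells, with boundary in degree `n`, of all the stages. -/
abbrev AllCells (n : ℤ) : Type u := ⨁ k : ℕ, (C.stage k).Cells n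

/-- The union of all the stages in degree `n`. -/
abbrev Total (n : ℤ) : Type u := C.X n × C.AllCells (n + 1)

/-- The inclusion of the `k`-th stage in the union. -/
noncomputable def stageInclusion : ∀ (k : ℕ) (n : ℤ), (C.stage k).X n →ₗ[R] C.Total n
  | 0, _ => LinearMap.inl R _ _
  | k + 1, n => LinearMap.coprod (stageInclusion k n) (LinearMap.inr R _ _ ∘ₗ
      DirectSum.lof R ℕ (fun k => (C.stage k).Cells (n + 1)) k)

theorem stageInclusion_succ (k : ℕ) (n : ℤ) (x : (C.stage k).X n)
    (q : (C.stage k).Cells (n + 1)) :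
    C.stageInclusion (k + 1) n (x, q) = C.stageInclusion k n x + LinearMap.inr R _ _
      (DirectSum.lof R ℕ (fun k => (C.stage k).Cells (n + 1)) k q) := rfl

theorem stageInclusion_snd_apply_eq_zero (k m : ℕ) (hkm : k ≤ m) (n : ℤ) (x : (C.stage k).X n) :
    (C.stageInclusion k n x).2 m = 0 := by
  induction k with
  | zero => rfl
  | succ k ih =>
    obtain ⟨x, q⟩ := x
    rw [stageInclusion_succ, Prod.snd_add, DirectSum.add_apply, ih (by lia), zero_add]
    exact DirectSum.of_eq_of_ne _ _ _ (by lia)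

theorem stageInclusion_injective (k : ℕ) (n : ℤ) :
    Function.Injective (C.stageInclusion k n) := by
  induction k with
  | zero => exact LinearMap.inl_injective
  | succ k ih =>
    rw [injective_iff_map_eq_zero]
    rintro ⟨x, q⟩ h
    rw [stageInclusion_succ] at h
    have hq : q = 0 := by
      have := congrArg (fun y => y.2 k) h
      simpa [stageInclusion_snd_apply_eq_zero, DirectSum.lof_apply] using this
    subst hq
    have hx : C.stageInclusion k n x = 0 := by rwa [map_zero, map_zero, add_zero] at h
    rw [(injective_iff_map_eq_zero _).1 ih x hx]
    rfl

theorem exists_stageInclusion_eq_of_le {k l : ℕ} (hkl : k ≤ l) (n : ℤ) (x : (C.stage k).X n) :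
    ∃ y, C.stageInclusion l n y = C.stageInclusion k n x := by
  induction l, hkl using Nat.le_induction with
  | base => exact ⟨x, rfl⟩
  | succ l _ ih =>
    obtain ⟨y, hy⟩ := ih
    exact ⟨(y, 0), by rw [stageInclusion_succ, map_zero, map_zero, add_zero, hy]⟩

theorem exists_stageInclusion_eq_inl (k : ℕ) (n : ℤ) (x : C.X n) :
    ∃ y, C.stageInclusion k n y = (x, 0) :=
  C.exists_stageInclusion_eq_of_le (Nat.zero_le k) n x

theorem exists_stageInclusion_eq (n : ℤ) (x : C.Total n) :
    ∃ k y, C.stageInclusion k n y = x := by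
  obtain ⟨x, p⟩ := x
  induction p using DirectSum.induction_on with
  | zero => exact ⟨0, x, rfl⟩
  | of k q =>
    obtain ⟨y, hy⟩ := C.exists_stageInclusion_eq_inl k n x
    refine ⟨k + 1, (y, q), ?_⟩
    rw [stageInclusion_succ, hy]
    simp [DirectSum.lof_eq_of]
  | add p q hp hq =>
    obtain ⟨k, y, hy⟩ := hp
    obtain ⟨l, z, hz⟩ := hq
    obtain ⟨y', hy'⟩ := C.exists_stageInclusion_eq_of_le (le_max_left k l) n y
    obtain ⟨z', hz'⟩ := C.exists_stageInclusion_eq_of_le (le_max_right k l) n z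
    obtain ⟨x', hx'⟩ := C.exists_stageInclusion_eq_inl (max k l) n x
    -- Both summands carry the component `x`, so one copy is subtracted.
    refine ⟨max k l, y' + z' - x', ?_⟩
    rw [map_sub, map_add, hy', hz', hx', hy, hz]
    simp

theorem exists_stageInclusion_eq_of_finite {κ : Type*} [Finite κ] (n : ℤ) (x : κ → C.Total n) :
    ∃ (k : ℕ) (y : κ → (C.stage k).X n), ∀ b, C.stageInclusion k n (y b) = x b := by
  choose k y hy using fun b => C.exists_stageInclusion_eq n (x b)
  obtain ⟨K, hK⟩ := Finite.bddAbove_range k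
  choose z hz using fun b => C.exists_stageInclusion_eq_of_le (hK ⟨b, rfl⟩) n (y b)
  exact ⟨K, z, fun b => (hz b).trans (hy b)⟩

/-- The attaching map of all cells of all stages. -/
noncomputable def totalAttachingMap (n : ℤ) : C.AllCells n →ₗ[R] C.Total n :=
  DirectSum.toModule R _ _ fun k => C.stageInclusion k n ∘ₗ (C.stage k).attachingMap n

@[simp]
theorem totalAttachingMap_lof (n : ℤ) (k : ℕ) (q : (C.stage k).Cells n) :
    C.totalAttachingMap n (DirectSum.lof R ℕ (fun k => (C.stage k).Cells n) k q) =
      C.stageInclusion k n ((C.stage k).attachingMap n q) := by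
  simp [totalAttachingMap]

/-- The differential of the union of all the stages. -/
noncomputable def totalD (n : ℤ) : C.Total n →ₗ[R] C.Total (n + 1) :=
  LinearMap.coprod (LinearMap.inl R _ _ ∘ₗ C.d n) (C.totalAttachingMap (n + 1))

theorem totalD_apply (n : ℤ) (x : C.X n) (p : C.AllCells (n + 1)) :
    C.totalD n (x, p) = LinearMap.inl R _ _ (C.d n x) + C.totalAttachingMap (n + 1) p := rfl

theorem totalD_inl (n : ℤ) (x : C.X n) :
    C.totalD n (LinearMap.inl R _ _ x) = LinearMap.inl R _ _ (C.d n x) := by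
  rw [LinearMap.inl_apply, totalD_apply, map_zero, add_zero]

theorem totalD_inr (n : ℤ) (p : C.AllCells (n + 1)) :
    C.totalD n (LinearMap.inr R _ _ p) = C.totalAttachingMap (n + 1) p := by
  rw [LinearMap.inr_apply, totalD_apply, map_zero, map_zero, zero_add]

theorem totalD_stageInclusion (k : ℕ) (n : ℤ) (x : (C.stage k).X n) :
    C.totalD n (C.stageInclusion k n x) = C.stageInclusion k (n + 1) ((C.stage k).d n x) := by
  induction k with
  | zero => exact C.totalD_inl n x
  | succ k ih =>
    obtain ⟨x, q⟩ := x
    change _ = C.stageInclusion (k + 1) (n + 1)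
      ((C.stage k).d n x + (C.stage k).attachingMap (n + 1) q, 0)
    rw [stageInclusion_succ, stageInclusion_succ, map_add, ih, totalD_inr, totalAttachingMap_lof,
      map_zero, map_zero, add_zero, map_add]

theorem totalD_totalAttachingMap (n : ℤ) (p : C.AllCells n) :
    C.totalD n (C.totalAttachingMap n p) = 0 := by
  have : C.totalD n ∘ₗ C.totalAttachingMap n = 0 := by
    refine DirectSum.linearMap_ext R fun k => ?_
    ext1 q
    simp [totalD_stageInclusion, d_attachingMap]
  exact LinearMap.congr_fun this p

/-- Tuples of cycles satisfying a system of linear equations are boundaries of tuples of cells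
satisfying the same system. -/
theorem exists_totalAttachingMap_eq (n : ℤ) (s : LinearSystem R) (x : Fin s.cols → C.Total n)
    (hx : ∀ b, C.totalD n (x b) = 0) (hs : ∀ a, ∑ b, s.coeff a b • x b = 0) :
    ∃ w : Fin s.cols → C.AllCells n,
      (∀ b, C.totalAttachingMap n (w b) = x b) ∧ ∀ a, ∑ b, s.coeff a b • w b = 0 := by
  classical
  obtain ⟨k, y, hy⟩ := C.exists_stageInclusion_eq_of_finite n x
  -- Injectivity of the stage inclusion lets both the equations and the cycle condition descend from
  -- the union to stage `k`.
  have hsy (a) : ∑ b, s.coeff a b • y b = 0 := C.stageInclusion_injective k n (by simp [hy, hs])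
  let att : s.Mod →ₗ[R] (C.stage k).X n := LinearSystem.desc y hsy
  have hatt : (C.stage k).d n ∘ₗ att = 0 := by
    refine LinearSystem.hom_ext fun j => C.stageInclusion_injective k (n + 1) ?_
    simp [att, ← totalD_stageInclusion, hy, hx]
  -- The tuple is itself the attaching map of a cell, so the generators of that cell bound it.
  let c : (C.stage k).Cell n := ⟨s, att, LinearMap.congr_fun hatt⟩
  let incl : s.Mod →ₗ[R] C.AllCells n :=
    DirectSum.lof R ℕ (fun k => (C.stage k).Cells n) k ∘ₗ (C.stage k).cellInclusion c
  refine ⟨fun b => incl (s.gen b), fun b => ?_, fun a => ?_⟩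
  · refine (C.totalAttachingMap_lof n k _).trans ?_
    rw [attachingMap_cellInclusion, ← hy b]
    exact congrArg _ (LinearSystem.desc_gen y hsy b)
  · simp only [← map_smul, ← map_sum, s.sum_smul_gen, map_zero]

/-- The differential on the sum of all cells. -/
noncomputable def cellD (n : ℤ) : C.AllCells n →ₗ[R] C.AllCells (n + 1) :=
  -(LinearMap.snd R _ _ ∘ₗ C.totalAttachingMap n)

/-- The map from the sum of all cells to the original sequence. -/
noncomputable def cellProj (n : ℤ) : C.AllCells n →ₗ[R] C.X n :=
  LinearMap.fst R _ _ ∘ₗ C.totalAttachingMap n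

theorem totalAttachingMap_eq (n : ℤ) (p : C.AllCells n) :
    C.totalAttachingMap n p = (C.cellProj n p, -C.cellD n p) := by
  simp [cellD, cellProj]

/-- These are the two coordinates of `totalD ∘ totalAttachingMap = 0`: the projection commutes with
the differentials, and the differential on cells squares to zero. -/
theorem d_cellProj_sub (n : ℤ) (p : C.AllCells n) :
    C.d n (C.cellProj n p) - C.cellProj (n + 1) (C.cellD n p) = 0 ∧
      C.cellD (n + 1) (C.cellD n p) = 0 := by
  have h := C.totalD_totalAttachingMap n p
  rw [totalAttachingMap_eq, totalD_apply, map_neg, totalAttachingMap_eq] at h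
  simpa [Prod.ext_iff, sub_eq_add_neg] using h

/-- Stage `k` involves only cells of index below `k`. With `g = 0` this gives the triangularity of
the differential demanded by `IsCellular`. -/
theorem comp_snd_stageInclusion_eq {T : Type*} [AddCommGroup T] [Module R T] {n : ℤ} (k : ℕ)
    (f g : C.AllCells (n + 1) →ₗ[R] T)
    (h : ∀ l < k, f ∘ₗ DirectSum.lof R ℕ (fun k => (C.stage k).Cells (n + 1)) l =
      g ∘ₗ DirectSum.lof R ℕ (fun k => (C.stage k).Cells (n + 1)) l) (x : (C.stage k).X n) :
    f (C.stageInclusion k n x).2 = g (C.stageInclusion k n x).2 := by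
  induction k with
  | zero => exact (map_zero f).trans (map_zero g).symm
  | succ k ih =>
    obtain ⟨x, q⟩ := x
    rw [stageInclusion_succ, Prod.snd_add, map_add, map_add,
      ih (fun l hl => h l (by lia)) x]
    congr 1
    exact LinearMap.congr_fun (h k (by lia)) q

end ModuleSeq

open CochainComplex.HomComplex

/-! ### Trivialising cocycles on a cellular complex. -/

section Cellular

variable {R : Type v} [Ring R]

/-- The terms of `P` are the sums of the modules `Q k i`, and the differential maps the `k`-th
summand to the sum of the previous ones. -/
structure IsCellular (P : CochainComplex (ModuleCat.{u} R) ℤ) (Q : ℕ → ℤ → ModuleCat.{u} R)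
    (incl : ∀ k i, Q k i ⟶ P.X i) : Prop where
  exists_desc : ∀ (i : ℤ) (T : ModuleCat.{u} R) (g : ∀ k, Q k i ⟶ T),
    ∃ l : P.X i ⟶ T, ∀ k, incl k i ≫ l = g k
  hom_ext : ∀ (i : ℤ) (T : ModuleCat.{u} R) (f g : P.X i ⟶ T),
    (∀ k, incl k i ≫ f = incl k i ≫ g) → f = g
  incl_d_comp : ∀ (k : ℕ) (i : ℤ) (T : ModuleCat.{u} R) (f : P.X (i + 1) ⟶ T),
    (∀ l < k, incl l (i + 1) ≫ f = 0) → incl k i ≫ P.d i (i + 1) ≫ f = 0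

variable {P : CochainComplex (ModuleCat.{u} R) ℤ} {Q : ℕ → ℤ → ModuleCat.{u} R}
  {incl : ∀ k i, Q k i ⟶ P.X i}

/-- The term `χ ∘ d_P` of the coboundary drops out, since `d_P` sends a cell of index `k` to cells
where `χ` vanishes. -/
theorem IsCellular.incl_δ_v (hP : IsCellular P Q incl) {Y : CochainComplex (ModuleCat.{u} R) ℤ}
    {m n : ℤ} (hmn : m + 1 = n) (χ : Cochain P Y m) (k : ℕ)
    (hχ : ∀ l < k, ∀ p q h, incl l p ≫ χ.v p q h = 0) (p q q' : ℤ) (hq' : p + m = q')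
    (hq : p + n = q) :
    incl k p ≫ (δ m n χ).v p q hq = incl k p ≫ χ.v p q' hq' ≫ Y.d q' q := by
  rw [δ_v m n hmn χ p q hq q' (p + 1) (by lia) rfl, Preadditive.comp_add, Linear.comp_units_smul,
    hP.incl_d_comp k p _ _ (fun l hl => hχ l hl _ _ _), smul_zero, add_zero]

/-- The induction step: a cocycle vanishing on earlier cells takes the `k`-th cells to cycles of
`Y`, so pure projectivity lifts it through `d_Y`. Extending the lift by zero to the other cells
leaves the earlier ones undisturbed. -/
theorem IsCellular.exists_correction (hP : IsCellular P Q incl)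
    (hQ : ∀ k i, IsPureProjective (Q k i)) {Y : CochainComplex (ModuleCat.{u} R) ℤ}
    (hY : IsPureExact Y) {m n : ℤ} (hmn : m + 1 = n) (φ : Cochain P Y n)
    (hφ : δ n (n + 1) φ = 0) (k : ℕ) (hk : ∀ l < k, ∀ p q h, incl l p ≫ φ.v p q h = 0) :
    ∃ χ : Cochain P Y m, (∀ l < k, ∀ p q h, incl l p ≫ χ.v p q h = 0) ∧
      ∀ l < k + 1, ∀ p q h, incl l p ≫ (φ - δ m n χ).v p q h = 0 := by
  have hcyc (p q q' : ℤ) (hq : p + n = q) (hq' : q + 1 = q') :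
      (incl k p ≫ φ.v p q hq) ≫ Y.d q q' = 0 := by
    have := hP.incl_δ_v rfl φ k hk p q' q hq (by lia)
    rw [hφ, Cochain.zero_v, comp_zero] at this
    rw [Category.assoc, ← this]
  have hlift (p : ℤ) := (hQ k p).exists_comp_d_eq hY (i := p + m) (j := p + n) (by lia) rfl
    (incl k p ≫ φ.v p (p + n) rfl) (hcyc p _ _ _ rfl)
  choose lft hlft using hlift
  have hdesc (p : ℤ) := hP.exists_desc p (Y.X (p + m))
    (fun l => if h : l = k then eqToHom (by rw [h]) ≫ lft p else 0)
  choose g hg using hdesc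
  let χ : Cochain P Y m := Cochain.mk fun p q h => g p ≫ eqToHom (by rw [h])
  have hχ (l p q h) (hl : l < k) : incl l p ≫ χ.v p q h = 0 := by
    subst h
    simp [χ, hg, hl.ne]
  refine ⟨χ, fun l hl p q h => hχ l p q h hl, fun l hl p q h => ?_⟩
  rw [Cochain.sub_v, Preadditive.comp_sub, hP.incl_δ_v hmn χ l
    (fun j hj p q h => hχ j p q h (by lia)) p q (p + m) rfl h]
  obtain hl | rfl := Nat.lt_succ_iff_lt_or_eq.1 hl
  · rw [hk l hl, ← Category.assoc, hχ _ _ _ _ hl, zero_comp, sub_zero]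
  · subst h
    have : incl l p ≫ χ.v p (p + m) rfl = lft p := by simp [χ, hg]
    rw [← Category.assoc, this, hlft, sub_self]

/-- Cocycles from a cellular complex with pure projective cells to a pure exact complex are
coboundaries. -/
theorem IsCellular.exists_δ_eq (hP : IsCellular P Q incl)
    (hQ : ∀ k i, IsPureProjective (Q k i)) {Y : CochainComplex (ModuleCat.{u} R) ℤ}
    (hY : IsPureExact Y) {m n : ℤ} (hmn : m + 1 = n) (φ : Cochain P Y n)
    (hφ : δ n (n + 1) φ = 0) : ∃ ψ : Cochain P Y m, δ m n ψ = φ := by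
  let Good (k : ℕ) (ψ : Cochain P Y m) : Prop :=
    ∀ l < k, ∀ p q h, incl l p ≫ (φ - δ m n ψ).v p q h = 0
  have step (k : ℕ) (ψ : {ψ // Good k ψ}) : ∃ ψ' : {ψ // Good (k + 1) ψ},
      ∀ l < k, ∀ p q h, incl l p ≫ (ψ'.1 - ψ.1).v p q h = 0 := by
    obtain ⟨χ, hχ, hχ'⟩ := hP.exists_correction hQ hY hmn (φ - δ m n ψ.1)
      (by rw [δ_sub, hφ, δ_δ, sub_zero]) k ψ.2
    refine ⟨⟨ψ.1 + χ, ?_⟩, ?_⟩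
    · intro l hl p q h
      rw [δ_add, ← sub_sub]
      exact hχ' l hl p q h
    · simpa using hχ
  choose next hnext using step
  -- The approximations no longer change on cells of index `l` from step `l + 1` on, so they glue to
  -- a limit.
  let seq : ∀ k, {ψ // Good k ψ} := fun k =>
    Nat.rec ⟨0, fun l hl => absurd hl (Nat.not_lt_zero l)⟩ next k
  have hseq (k l : ℕ) (hl : l < k) (p q h) :
      incl l p ≫ (seq k).1.v p q h = incl l p ≫ (seq (l + 1)).1.v p q h := by
    induction k, hl using Nat.le_induction with
    | base => rfl
    | succ k hk ih =>
      have := hnext k (seq k) l hk p q h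
      rw [Cochain.sub_v, Preadditive.comp_sub, sub_eq_zero] at this
      rw [← ih]
      exact this
  have hdesc (p : ℤ) := hP.exists_desc p (Y.X (p + m))
    (fun l => incl l p ≫ (seq (l + 1)).1.v p (p + m) rfl)
  choose g hg using hdesc
  let ψ : Cochain P Y m := Cochain.mk fun p q h => g p ≫ eqToHom (by rw [h])
  have hψ (l p q h) : incl l p ≫ ψ.v p q h = incl l p ≫ (seq (l + 1)).1.v p q h := by
    subst h
    simp [ψ, hg]
  refine ⟨ψ, Cochain.ext _ _ fun p q h => hP.hom_ext _ _ _ _ fun k => ?_⟩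
  have h₁ := (seq (k + 1)).2 k (Nat.lt_succ_self k) p q h
  have h₂ (l) (hl : l < k + 1) (p q h) : incl l p ≫ (ψ - (seq (k + 1)).1).v p q h = 0 := by
    rw [Cochain.sub_v, Preadditive.comp_sub, hψ, hseq (k + 1) l hl, sub_self]
  -- The limit and the `(k + 1)`-st approximation agree on cells up to index `k`, so by
  -- triangularity their coboundaries agree on cells of index `k`.
  have h₃ := hP.incl_δ_v hmn (ψ - (seq (k + 1)).1) k (fun l hl => h₂ l (by lia)) p q (p + m) rfl h
  rw [← Category.assoc, h₂ k (Nat.lt_succ_self k), zero_comp, δ_sub, Cochain.sub_v,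
    Preadditive.comp_sub, sub_eq_zero] at h₃
  rw [Cochain.sub_v, Preadditive.comp_sub, sub_eq_zero] at h₁
  rw [h₁, h₃]

end Cellular

/-! ### Solutions of integral linear systems in a complex -/

section Solutions

variable {R : Type v} [Ring R] {ι κ : Type} [Fintype κ] (b : ι → κ → ℤ)

/-- The solutions in `N` of a system of integral linear equations. -/
def solutions (N : Type*) [AddCommGroup N] [Module R N] : Submodule R (κ → N) where
  carrier := {y | ∀ i, ∑ j, b i j • y j = 0}
  zero_mem' := by simp
  add_mem' {x y} hx hy i := by
    rw [Set.mem_ofPred_eq] at hx hy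
    simp [Finset.sum_add_distrib, hx, hy]
  smul_mem' r x hx i := by
    rw [Set.mem_ofPred_eq] at hx
    simp only [Pi.smul_apply, smul_comm _ r, ← Finset.smul_sum, hx, smul_zero]

/-- The functor sending a module to the module of solutions of a system of integral linear
equations. -/
def solutionsFunctor : ModuleCat.{u} R ⥤ ModuleCat.{u} R where
  obj N := ModuleCat.of R (solutions (R := R) b N)
  map {N N'} f := ModuleCat.ofHom ((f.hom.compLeft κ).restrict fun y hy i => by
    simpa using congrArg f.hom (hy i))

instance : (solutionsFunctor (R := R) b).Additive where

/-- The complex of solutions of a system of integral linear equations. -/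
def solutionsComplex (Y : CochainComplex (ModuleCat.{u} R) ℤ) :
    CochainComplex (ModuleCat.{u} R) ℤ :=
  ((solutionsFunctor b).mapHomologicalComplex _).obj Y

variable {b} {Y : CochainComplex (ModuleCat.{u} R) ℤ}

theorem solutionsComplex_d_apply (i j : ℤ) (y : (solutionsComplex b Y).X i) (s : κ) :
    (((solutionsComplex b Y).d i j).hom y).1 s = (Y.d i j).hom (y.1 s) := rfl

theorem solutionsComplex_coe_sum_smul {κ' : Type} [Fintype κ'] (i : ℤ) (r : κ' → R)
    (y : κ' → (solutionsComplex b Y).X i) (s : κ) :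
    (∑ t, r t • y t).1 s = ∑ t, r t • (y t).1 s := by
  have : (∑ t, r t • y t).1 = ∑ t, r t • (y t).1 :=
    (map_sum (solutions (R := R) b (Y.X i)).subtype _ _)
  rw [this, Finset.sum_apply]
  rfl

/-- A tuple of solutions is a matrix of elements of `Y` satisfying `r` along one index and `b` along
the other. Together these form one finite system over `R`, to which linear exactness of `Y` applies.
-/
theorem IsLinearlyExact.solutionsComplex [Fintype ι] (hY : IsLinearlyExact Y) :
    IsLinearlyExact (solutionsComplex b Y) := by
  classical
  intro i j k hij hjk ι' κ' _ _ r x hx hrx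
  obtain ⟨w, hw, hrw⟩ := hY i j k hij hjk ((ι' × κ) ⊕ (ι × κ')) (κ' × κ)
    (Sum.elim (fun a c => if a.2 = c.2 then r a.1 c.1 else 0)
      (fun a c => if a.2 = c.1 then (b a.1 c.2 : R) else 0))
    (fun c => (x c.1).1 c.2)
    (fun c => by rw [← solutionsComplex_d_apply, hx]; rfl)
    (by
      rintro (⟨a, s⟩ | ⟨a, t⟩)
      · have : ∑ t, r a t • (x t).1 s = 0 :=
          (solutionsComplex_coe_sum_smul j (r a) x s).symm.trans
            (congrArg (fun y => y.1 s) (hrx a))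
        simpa [Fintype.sum_prod_type, ite_smul] using this
      · have := (x t).2 a
        simpa [Fintype.sum_prod_type_right, ite_smul, Int.cast_smul_eq_zsmul] using this)
  have h₁ (a : ι') (s : κ) : ∑ t, r a t • w (t, s) = 0 := by
    simpa [Fintype.sum_prod_type, ite_smul] using hrw (Sum.inl (a, s))
  have h₂ (t : κ') (a : ι) : ∑ s, b a s • w (t, s) = 0 := by
    simpa [Fintype.sum_prod_type_right, ite_smul, Int.cast_smul_eq_zsmul] using hrw (Sum.inr (a, t))
  refine ⟨fun t => ⟨fun s => w (t, s), h₂ t⟩, fun t => ?_, fun a => ?_⟩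
  · exact Subtype.ext (funext fun s => hw (t, s))
  · refine Subtype.ext (funext fun s => ?_)
    exact (solutionsComplex_coe_sum_smul i (r a) _ s).trans (h₁ a s)

variable (b Y) in
/-- The projections from the complex of solutions. -/
def solutionsProj (s : κ) : solutionsComplex b Y ⟶ Y where
  f _ := ModuleCat.ofHom (LinearMap.proj s ∘ₗ Submodule.subtype _)
  comm' _ _ _ := rfl

/-- Cochains with values in the complex of solutions are tuples of cochains solving the system. -/
theorem exists_comp_solutionsProj_eq {P : CochainComplex (ModuleCat.{u} R) ℤ} {n : ℤ}
    (φ : κ → Cochain P Y n) (hφ : ∀ i, ∑ j, b i j • φ j = 0) :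
    ∃ Φ : Cochain P (solutionsComplex b Y) n,
      ∀ j, Φ.comp (Cochain.ofHom (solutionsProj b Y j)) (add_zero n) = φ j := by
  have h (p q hpq) (x : P.X p) (i) : ∑ j, b i j • ((φ j).v p q hpq).hom x = 0 := by
    let ev : Cochain P Y n →+ Y.X q := AddMonoidHom.mk' (fun ψ => (ψ.v p q hpq).hom x)
      fun _ _ => rfl
    have h0 := congrArg ev (hφ i)
    simp only [map_sum, map_zsmul, map_zero] at h0
    exact h0
  refine ⟨Cochain.mk fun p q hpq => ModuleCat.ofHom ((LinearMap.pi fun j =>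
    ((φ j).v p q hpq).hom).codRestrict (solutions b (Y.X q)) (h p q hpq)), fun j => ?_⟩
  ext p q hpq x
  rw [Cochain.comp_zero_cochain_v, Cochain.ofHom_v]
  rfl

theorem ext_comp_solutionsProj {P : CochainComplex (ModuleCat.{u} R) ℤ} {n : ℤ}
    {Φ Ψ : Cochain P (solutionsComplex b Y) n}
    (h : ∀ j, Φ.comp (Cochain.ofHom (solutionsProj b Y j)) (add_zero n) =
      Ψ.comp (Cochain.ofHom (solutionsProj b Y j)) (add_zero n)) : Φ = Ψ := by
  ext p q hpq x
  refine Subtype.ext (funext fun j => ?_)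
  have := congrArg (fun f => f.hom x) (Cochain.congr_v (h j) p q hpq)
  rwa [Cochain.comp_zero_cochain_v, Cochain.comp_zero_cochain_v, Cochain.ofHom_v] at this

theorem sum_smul_comp_solutionsProj {P : CochainComplex (ModuleCat.{u} R) ℤ} {n : ℤ}
    (Φ : Cochain P (solutionsComplex b Y) n) (i : ι) :
    ∑ j, b i j • Φ.comp (Cochain.ofHom (solutionsProj b Y j)) (add_zero n) = 0 := by
  ext p q hpq x
  let ev : Cochain P Y n →+ Y.X q := AddMonoidHom.mk' (fun ψ => (ψ.v p q hpq).hom x)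
    fun _ _ => rfl
  have hev (j) : ev (Φ.comp (Cochain.ofHom (solutionsProj b Y j)) (add_zero n)) =
      ((Φ.v p q hpq).hom x).1 j := by
    refine (congrArg (fun f => f.hom x) (Cochain.comp_zero_cochain_v Φ
      (Cochain.ofHom (solutionsProj b Y j)) p q hpq)).trans ?_
    rw [Cochain.ofHom_v]
    rfl
  change ev _ = 0
  simp only [map_sum, map_zsmul, hev]
  exact ((Φ.v p q hpq).hom x).2 i

end Solutions

/-- If `Hom_R(P, -)` takes pure exact complexes to exact complexes, then it takes them to pure
exact complexes. -/
theorem isPureExact_homComplex {R : Type u} [Ring R] {P : CochainComplex (ModuleCat.{u} R) ℤ}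
    (hP : ∀ Y : CochainComplex (ModuleCat.{u} R) ℤ, IsPureExact Y → ∀ (m n : ℤ), m + 1 = n →
      ∀ φ : Cochain P Y n, δ n (n + 1) φ = 0 → ∃ ψ : Cochain P Y m, δ m n ψ = φ)
    (Y : CochainComplex (ModuleCat.{u} R) ℤ) (hY : IsPureExact Y) :
    IsPureExact (homComplex P Y) := by
  refine IsLinearlyExact.isPureExact ?_
  rintro i j k hij rfl ι κ _ _ b φ hφ hb
  change κ → Cochain P Y j at φ
  replace hφ (s) : δ j (j + 1) (φ s) = 0 := hφ s
  -- The tuple of cocycles becomes a single cocycle into the complex of solutions; the projections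
  -- of a cochain bounding it automatically satisfy the equations.
  obtain ⟨Φ, hΦ⟩ := exists_comp_solutionsProj_eq φ hb
  have hδ : δ j (j + 1) Φ = 0 := ext_comp_solutionsProj fun s => by
    rw [← δ_comp_ofHom, hΦ, hφ, Cochain.zero_comp]
  obtain ⟨Ψ, hΨ⟩ := hP _ (hY.isLinearlyExact.solutionsComplex (b := b)).isPureExact i j hij Φ hδ
  refine ⟨fun s => Ψ.comp (Cochain.ofHom (solutionsProj b Y s)) (add_zero i), fun s => ?_,
    fun a => sum_smul_comp_solutionsProj Ψ a⟩
  change δ i j _ = _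
  rw [δ_comp_ofHom, hΨ, hΦ]

/-! ### The complex of cells as a resolution. -/

namespace ModuleSeq

variable {R : Type u} [Ring R]

/-- The sequence of modules underlying a cochain complex. -/
def ofComplex (X : CochainComplex (ModuleCat.{u} R) ℤ) : ModuleSeq R where
  X := X.X
  d n := (X.d n (n + 1)).hom
  d_d n x := by
    rw [← LinearMap.comp_apply, ← ModuleCat.hom_comp, X.d_comp_d]
    rfl

variable (C : ModuleSeq R)

/-- The complex of all cells. -/
noncomputable def cellComplex : CochainComplex (ModuleCat.{u} R) ℤ :=
  CochainComplex.of (fun n => ModuleCat.of R (C.AllCells n)) (fun n => ModuleCat.ofHom (C.cellD n))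
    fun n => by
      ext1
      exact LinearMap.ext fun p => (C.d_cellProj_sub n p).2

theorem cellComplex_d (n : ℤ) : C.cellComplex.d n (n + 1) = ModuleCat.ofHom (C.cellD n) :=
  CochainComplex.of_d (fun n => ModuleCat.of R (C.AllCells n))
    (fun n => ModuleCat.ofHom (C.cellD n)) n

theorem isPureProjective_cellComplex (n : ℤ) : IsPureProjective (C.cellComplex.X n) :=
  isPureProjective_directSum.{0, u} (fun k => (C.stage k).Cells n)
    fun k => (C.stage k).isPureProjective_cells n

theorem isCellular_cellComplex :
    IsCellular C.cellComplex (fun k n => ModuleCat.of R ((C.stage k).Cells n))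
      (fun k n => ModuleCat.ofHom (DirectSum.lof R ℕ (fun k => (C.stage k).Cells n) k)) where
  exists_desc i T g := by
    let l : C.AllCells i →ₗ[R] T := DirectSum.toModule R ℕ T fun k => (g k).hom
    refine ⟨ModuleCat.ofHom l, fun k => ?_⟩
    ext q
    exact DirectSum.toModule_lof (M := fun k => (C.stage k).Cells i)
      (φ := fun k => (g k).hom) R k q
  hom_ext i T f g h := by
    have h' : (f.hom : C.AllCells i →ₗ[R] T) = g.hom :=
      DirectSum.linearMap_ext R fun k => congrArg ModuleCat.Hom.hom (h k)
    exact ModuleCat.hom_ext h'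
  incl_d_comp k i T f h := by
    rw [cellComplex_d]
    ext q
    have h' := C.comp_snd_stageInclusion_eq k f.hom 0
      (fun l hl => congrArg ModuleCat.Hom.hom (h l hl)) ((C.stage k).attachingMap i q)
    change f.hom (C.cellD i (DirectSum.lof R ℕ (fun k => (C.stage k).Cells i) k q)) = 0
    rw [cellD, LinearMap.neg_apply, LinearMap.comp_apply, totalAttachingMap_lof]
    exact (map_neg f.hom _).trans (neg_eq_zero.2 h')

/-- The map from the complex of all cells to the original complex. -/
noncomputable def cellComplexProj (X : CochainComplex (ModuleCat.{u} R) ℤ) :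
    (ofComplex X).cellComplex ⟶ X where
  f n := ModuleCat.ofHom ((ofComplex X).cellProj n)
  comm' := by
    rintro n _ rfl
    rw [cellComplex_d]
    ext p
    exact sub_eq_zero.1 ((ofComplex X).d_cellProj_sub n p).1

end ModuleSeq

/-- Reindexing by `Fin` restricts the test to `LinearSystem R`, a type in the universe of `R`, which
allows one cell for every attaching map. -/
theorem isLinearlyExact_iff_linearSystem {R : Type u} [Ring R]
    {X : CochainComplex (ModuleCat.{u} R) ℤ} :
    IsLinearlyExact X ↔ ∀ (n : ℤ) (s : LinearSystem R) (x : Fin s.cols → X.X (n + 1)),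
      (∀ b, (X.d (n + 1) (n + 1 + 1)).hom (x b) = 0) → (∀ a, ∑ b, s.coeff a b • x b = 0) →
      ∃ w : Fin s.cols → X.X n, (∀ b, (X.d n (n + 1)).hom (w b) = x b) ∧
        ∀ a, ∑ b, s.coeff a b • w b = 0 := by
  refine ⟨fun h n s x hx hs => h n _ _ rfl rfl _ _ s.coeff x hx hs, ?_⟩
  rintro h i _ _ rfl rfl ι κ _ _ r x hx hr
  let e := Fintype.equivFin ι
  let e' := Fintype.equivFin κ
  obtain ⟨w, hw, hrw⟩ := h i ⟨_, _, fun a b => r (e.symm a) (e'.symm b)⟩ (fun b => x (e'.symm b))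
    (fun b => hx _) (fun a => by
      rw [← hr (e.symm a)]
      exact Equiv.sum_comp e'.symm fun b => r (e.symm a) b • x b)
  refine ⟨fun b => w (e' b), fun b => by simp [hw], fun a => ?_⟩
  rw [← Equiv.sum_comp e'.symm]
  simpa using hrw (e a)

open CochainComplex in
/-- The mapping cone of the projection from the complex of cells is pure exact. The complex `X` need
not be bounded. -/
theorem isPureQuasiIso_cellComplexProj {R : Type u} [Ring R]
    (X : CochainComplex (ModuleCat.{u} R) ℤ) : IsPureQuasiIso (ModuleSeq.cellComplexProj X) := by
  refine IsLinearlyExact.isPureExact (isLinearlyExact_iff_linearSystem.2 fun n s y hy hs => ?_)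
  let C := ModuleSeq.ofComplex X
  let φ : C.cellComplex ⟶ X := ModuleSeq.cellComplexProj X
  change Fin s.cols → (mappingCone φ).X (n + 1) at y
  -- In degree `n + 1` the cone and the union of the stages have the same two components, and `hker`
  -- transports cycles from the cone to the union.
  let toTotal : (mappingCone φ).X (n + 1) →ₗ[R] C.Total (n + 1) := LinearMap.prod
    ((mappingCone.snd φ).v (n + 1) (n + 1) (add_zero _)).hom
    ((mappingCone.fst φ).1.v (n + 1) (n + 1 + 1) rfl).hom
  have hker (z : (mappingCone φ).X (n + 1))
      (hz : ((mappingCone φ).d (n + 1) (n + 1 + 1)).hom z = 0) :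
      C.totalD (n + 1) (toTotal z) = 0 := by
    have h₁ := congrArg (fun f => f.hom z)
      (mappingCone.d_fst_v φ (n + 1) (n + 1 + 1) (n + 1 + 1 + 1) rfl rfl)
    have h₂ := congrArg (fun f => f.hom z) (mappingCone.d_snd_v φ (n + 1) (n + 1 + 1) rfl)
    simp only [ModuleCat.hom_comp, LinearMap.comp_apply, hz, map_zero] at h₁ h₂
    rw [C.cellComplex_d] at h₁
    refine (C.totalD_apply _ _ _).trans ?_
    rw [C.totalAttachingMap_eq]
    refine Prod.ext ?_ ?_
    · exact (add_comm _ _).trans h₂.symm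
    · exact (zero_add _).trans h₁.symm
  obtain ⟨w, hw, hsw⟩ := C.exists_totalAttachingMap_eq (n + 1) s (fun b => toTotal (y b))
    (fun b => hker _ (hy b)) (fun a => by
      simp only [← map_smul, ← map_sum]
      exact (congrArg toTotal (hs a)).trans (map_zero _))
  -- The boundary in the cone of a cell `w` has components `φ w` and `-d w`, which are those of
  -- `totalAttachingMap`. The bounding tuple therefore needs no component in `X`.
  let inl : C.AllCells (n + 1) →ₗ[R] (mappingCone φ).X n := ((mappingCone.inl φ).v (n + 1) n (by lia)).hom
  refine ⟨fun b => inl (w b), fun b => ?_, fun a => ?_⟩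
  · have h₁ := congrArg (fun f => f.hom (w b))
      (mappingCone.inl_v_d φ (n + 1) n (n + 1 + 1) (by lia) (by lia))
    have h₂ := congrArg (fun f => f.hom (y b))
      (mappingCone.id_X φ (n + 1) (n + 1 + 1) rfl)
    have h₃ := hw b
    rw [C.totalAttachingMap_eq] at h₃
    have h₄ : (φ.f (n + 1)).hom (w b) =
      ((mappingCone.snd φ).v (n + 1) (n + 1) (add_zero _)).hom (y b) := congrArg Prod.fst h₃
    have h₅ : -(C.cellComplex.d (n + 1) (n + 1 + 1)).hom (w b) =
        ((mappingCone.fst φ).1.v (n + 1) (n + 1 + 1) rfl).hom (y b) := by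
      rw [C.cellComplex_d]
      exact congrArg Prod.snd h₃
    simp only [ModuleCat.hom_comp, ModuleCat.hom_add, ModuleCat.hom_sub, LinearMap.add_apply,
      LinearMap.comp_apply, ← h₄, ← h₅, map_neg] at h₁ h₂
    refine h₁.trans (Eq.trans ?_ h₂)
    exact sub_eq_neg_add _ _
  · have := congrArg inl (hsw a)
    simp only [map_sum, map_smul, map_zero] at this
    exact this

end PureComplex

theorem theorem5p1 {R : Type u} [Ring R] (X : CochainComplex (ModuleCat.{u} R) ℤ)
    (hX : ∃ n : ℤ, ∀ i : ℤ, i < n → IsZero (X.X i)) :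
    ∃ (P : CochainComplex (ModuleCat.{u} R) ℤ) (f : P ⟶ X),
      PureComplex.IsPureProjectiveResolution f := by
  let C := PureComplex.ModuleSeq.ofComplex X
  refine ⟨C.cellComplex, PureComplex.ModuleSeq.cellComplexProj X,
    C.isPureProjective_cellComplex, PureComplex.isPureQuasiIso_cellComplexProj X,
    PureComplex.isPureExact_homComplex fun Y hY m n hmn φ hφ => ?_⟩
  exact C.isCellular_cellComplex.exists_δ_eq (fun k n => (C.stage k).isPureProjective_cells n)
    hY hmn φ hφ
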